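/- All groups are discrete. A unitary representation $\pi:G\to\mathcal U(\mathcal H)$ of a countable group $G$ on a complex Hilbert space *has almost invariant vectors* if for every $\varepsilon>0$ and every finite $F\subset G$ there is a unit vector $\xi\in\mathcal H$ with $\|\pi(g)\xi-\xi\|\le\varepsilon$ for all $g\in F$; it is $c_0$ if $\lim_{g\to\infty}\langle\pi(g)\xi,\eta\rangle=0$ for all $\xi,\eta\in\mathcal H$. The group $G$ is *Haagerup* if it admits a $c_0$ unitary representation which has almost invariant vectors. For a subset $X\subset G$, the group $G$ *has relative property (T) with respect to $X$* if for every unitary representation $\pi:G\to\mathcal U(\mathcal H)$ which has almost invariant vectors and every $\varepsilon>0$ there is a unit vector $\xi\in\mathcal H$ with $\|\pi(g)\xi-\xi\|\le\varepsilon$ for all $g\in X$. **Theorem 3.1.** Let $\Gamma_0$ be a countable group, $A$ a countable abelian group, and $\rho:\Gamma_0\to\mathrm{Aut}(A)$ an action by automorphisms. Let $\Gamma$ be a countable group with a surjective homomorphism $p:\Gamma\to\Gamma_0$, and let $\tilde\rho=\rho\circ p:\Gamma\to\mathrm{Aut}(A)$. (1) Let $X\subset\Gamma_0$ be a subset such that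 $\Gamma_0$ has relative property (T) with respect to $X$. For $a\in A$ let $X_a=\{\rho(\gamma)(a)\mid\gamma\in X\}\subset A\subset A\rtimes_{\tilde\rho}\Gamma$. Then $A\rtimes_{\tilde\rho}\Gamma$ has relative property (T) with respect to $X_a$, for every $a\in A$. (2) Assume that there is $a\in A$ whose stabilizer $\{\gamma\in\Gamma_0\mid\rho(\gamma)(a)=a\}$ in $\Gamma_0$ is finite. If $\Gamma_0$ is not Haagerup, then $A\rtimes_{\tilde\rho}\Gamma$ is not Haagerup. -/

import Mathlib

universe v

namespace CountableGroup

/-- A unitary representation `π : G → 𝓤(H)` of a discrete group has almost invariant vectors: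
for every `ε > 0` and every finite (that is, compact) `F ⊆ G` there is a unit vector moved by at
most `ε` by every element of `F`. -/
def HasAlmostInvariantVectors {G : Type*} [Group G] {H : Type*} [NormedAddCommGroup H]
    [InnerProductSpace ℂ H] [CompleteSpace H] (π : G →* unitary (H →L[ℂ] H)) : Prop :=
  ∀ ε : ℝ, 0 < ε → ∀ F : Finset G,
    ∃ ξ : H, ‖ξ‖ = 1 ∧ ∀ g ∈ F, ‖(π g : H →L[ℂ] H) ξ - ξ‖ ≤ ε

/-- A unitary representation of a discrete group is `c₀` (mixing): all its matrix coefficients tend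
to `0` at infinity, i.e. along the filter of complements of finite subsets of `G`. -/
def IsC0 {G : Type*} [Group G] {H : Type*} [NormedAddCommGroup H]
    [InnerProductSpace ℂ H] [CompleteSpace H] (π : G →* unitary (H →L[ℂ] H)) : Prop :=
  ∀ ξ η : H, Filter.Tendsto (fun g : G => inner ℂ ((π g : H →L[ℂ] H) ξ) η)
    Filter.cofinite (nhds 0)

/-- The inclusion `X ⊆ G` of a subset of a discrete group has relative property (T): every unitary
representation of `G` on a complex Hilbert space that has almost invariant vectors has, for every
`ε > 0`, a unit vector moved by at most `ε` by all elements of `X` simultaneously.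
The Hilbert spaces range over an arbitrary universe `v`; for countable groups the notion does not
depend on `v`, since one may pass to separable subrepresentations. -/
def HasRelativePropertyT {G : Type*} [Group G] (X : Set G) : Prop :=
  ∀ (H : Type v) [NormedAddCommGroup H] [InnerProductSpace ℂ H] [CompleteSpace H]
    (π : G →* unitary (H →L[ℂ] H)), HasAlmostInvariantVectors π →
    ∀ ε : ℝ, 0 < ε → ∃ ξ : H, ‖ξ‖ = 1 ∧ ∀ g ∈ X, ‖(π g : H →L[ℂ] H) ξ - ξ‖ ≤ ε

/-- A discrete group has Haagerup's property if it admits a `c₀` unitary representation on a complex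
Hilbert space that has almost invariant vectors. (The universe `v` is again immaterial for countable
groups.) -/
def IsHaagerup (G : Type*) [Group G] : Prop :=
  ∃ (H : Type v) (_ : NormedAddCommGroup H) (_ : InnerProductSpace ℂ H) (_ : CompleteSpace H)
    (π : G →* unitary (H →L[ℂ] H)), IsC0 π ∧ HasAlmostInvariantVectors π

end CountableGroup

-- Let `π` be a unitary representation of the semidirect product with almost invariant unit vectors
-- `ξ n`. Restricted to `A`, each `ξ n` has a spectral measure `μ n` on the dual of `A`, and `Γ`
-- moves these measures. The Hellinger affinity `φ n γ = ∫ √(dμ n · d(γ μ n))` depends only on the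
-- image `γ` of the group element in `Γ₀`, because the kernel of `p` commutes with `A`. It is a
-- normalized function of positive type on `Γ₀`, and it tends to `1` pointwise because the `ξ n` are
-- almost invariant. Measures are avoided: the affinity is an infimum over finite positive
-- partitions of unity in the bicommutant of `π(A)`.
--
-- Affinity controls Fourier coefficients: if `φ n γ` is near `1`, then the real parts of the
-- coefficients of `π` at `a` and `ρ γ a` are close (`sq_sub_le_one_sub_spectralAffinity`). For (1),
-- relative property (T) makes some `φ n` close to `1` on all of `X`, so `ξ n` is almost fixed by
-- all of `X_a`. For (2), if `π` is `c₀` and `a` has finite stabilizer, then `ρ γ a` goes to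
-- infinity with `γ`, its coefficient tends to `0`, and `φ n` stays below a constant `c < 1` off a
-- finite set.
--
-- Both uses of the `φ n` need decay from a mere gap `c < 1`. It comes from the infinite products of
-- the powers `φ (n k) ^ k` along a sparse subsequence: their tails tend to `1`, but are at most `c
-- ^ k` wherever `φ (n k) ≤ c` (`exists_subseq_tailProd`).

universe u

section

open scoped ComplexOrder
open Filter Topology

/-! ### Hilbert spaces and representations from invariant kernels -/

/-- The GNS construction for an invariant positive semidefinite kernel on a small `G`-set. -/
theorem exists_unitaryRepresentation_of_kernel {G S : Type*} [Group G] [MulAction G S]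
    [Small.{v} S] (K : Matrix S S ℂ) (hK : K.PosSemidef)
    (hinv : ∀ (g : G) (s t : S), K (g • s) (g • t) = K s t) :
    ∃ (H : Type v) (_ : NormedAddCommGroup H) (_ : InnerProductSpace ℂ H) (_ : CompleteSpace H)
      (π : G →* unitary (H →L[ℂ] H)) (e : S → H),
      (∀ s t, inner ℂ (e s) (e t) = K s t) ∧
      (∀ g s, (π g : H →L[ℂ] H) (e s) = e (g • s)) ∧
      DenseRange (Finsupp.linearCombination ℂ e) := by
  -- Shrinking the index set places the Hilbert space in the prescribed universe `v`.
  let r : Shrink.{v} S → S := (equivShrink S).symm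
  let L : Matrix (Shrink.{v} S) (Shrink.{v} S) (ℂ →L[ℂ] ℂ) :=
    Matrix.of fun s t => K (r s) (r t) • ContinuousLinearMap.id ℂ ℂ
  have hLa : ∀ s t, L s t = K (r s) (r t) • ContinuousLinearMap.id ℂ ℂ := fun _ _ => rfl
  have hL : L.PosSemidef := by
    rw [RKHS.posSemidef_tfae.out 0 2 (a := L.PosSemidef) rfl rfl]
    refine ⟨?_, fun v => ?_⟩
    · ext s t
      rw [Matrix.conjTranspose_apply, hLa, hLa, star_smul, hK.isHermitian.apply]
      exact congrArg (fun T : ℂ →L[ℂ] ℂ => (K (r s) (r t) • T) 1)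
        (ContinuousLinearMap.adjoint_id (𝕜 := ℂ) (E := ℂ))
    · have h := (hK.submatrix r).2 v
      have h2 := (Complex.le_def.1 h).1
      refine h2.trans_eq ?_
      simp only [hLa, Matrix.submatrix_apply]
      refine congrArg Complex.re ?_
      refine Finsupp.sum_congr fun s _ => Finsupp.sum_congr fun t _ => ?_
      rw [← hK.isHermitian.apply (r s) (r t)]
      simp [mul_comm, mul_left_comm]
  have : Fact L.PosSemidef := ⟨hL⟩
  let e : S → RKHS.OfKernel L := fun s => RKHS.kerFun (RKHS.OfKernel L) (equivShrink S s) 1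
  have he : ∀ s t, inner ℂ (e s) (e t) = K s t := fun s t => by
    simp only [e]
    rw [← RKHS.kernel_inner, RKHS.OfKernel.kernel_ofKernel, ← hK.isHermitian.apply]
    simp [hLa, r]
  have hdense : DenseRange (Finsupp.linearCombination ℂ e) := by
    have h := RKHS.kerFun_dense (RKHS.OfKernel L)
    have h2 : Submodule.span ℂ {x | ∃ s v, RKHS.kerFun (RKHS.OfKernel L) s v = x} ≤
        LinearMap.range (Finsupp.linearCombination ℂ e) := by
      rw [Submodule.span_le]
      rintro _ ⟨s, v, rfl⟩
      refine ⟨Finsupp.single ((equivShrink S).symm s) v, ?_⟩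
      simp [e, ← map_smul]
    have h3 := Submodule.topologicalClosure_mono h2
    rw [h, top_le_iff] at h3
    have h4 := congrArg (fun p : Submodule ℂ (RKHS.OfKernel L) => (p : Set (RKHS.OfKernel L))) h3
    rw [DenseRange, dense_iff_closure_eq]
    simpa only [Submodule.topologicalClosure_coe, LinearMap.coe_range, Submodule.top_coe] using h4
  let T : G → (S →₀ ℂ) ≃ₗ[ℂ] (S →₀ ℂ) := fun g =>
    Finsupp.domLCongr (R := ℂ) (MulAction.toPerm g : Equiv.Perm S)
  have hT : ∀ g s c, T g (Finsupp.single s c) = Finsupp.single (g • s) c := fun g s c => by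
    simp [T]
  have key : ∀ (g : G) (x : S →₀ ℂ),
      ‖Finsupp.linearCombination ℂ e (T g x)‖ = ‖Finsupp.linearCombination ℂ e x‖ := fun g x => by
    have h : inner ℂ (Finsupp.linearCombination ℂ e (T g x))
        (Finsupp.linearCombination ℂ e (T g x)) =
        inner ℂ (Finsupp.linearCombination ℂ e x) (Finsupp.linearCombination ℂ e x) := by
      simp only [T, Finsupp.linearCombination_apply, Finsupp.domLCongr_apply,
        Finsupp.domCongr_apply, Finsupp.sum_equivMapDomain, Finsupp.sum_inner,
        Finsupp.inner_sum, inner_smul_left, inner_smul_right, he, hinv,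
        MulAction.toPerm_apply]
    rw [inner_self_eq_norm_sq_to_K, inner_self_eq_norm_sq_to_K] at h
    norm_cast at h
    exact (sq_eq_sq₀ (norm_nonneg _) (norm_nonneg _)).1 h
  let U : G → (RKHS.OfKernel L ≃ₗᵢ[ℂ] RKHS.OfKernel L) := fun g =>
    LinearEquiv.extendOfIsometry (T g) _ _ hdense hdense (key g)
  have hU : ∀ g s, U g (e s) = e (g • s) := fun g s => by
    have h := LinearEquiv.extendOfIsometry_eq (T g) _ _
      hdense hdense (key g) (Finsupp.single s 1)
    simpa [hT] using h
  have hext : ∀ (V W : RKHS.OfKernel L ≃ₗᵢ[ℂ] RKHS.OfKernel L),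
      (∀ s, V (e s) = W (e s)) → V = W := fun V W h => by
    refine LinearIsometryEquiv.ext fun x => ?_
    refine congrFun (hdense.equalizer V.continuous W.continuous (funext fun x => ?_)) x
    simp [Finsupp.linearCombination_apply, Finsupp.sum, h]
  let U' : G →* (RKHS.OfKernel L ≃ₗᵢ[ℂ] RKHS.OfKernel L) :=
    { toFun := U
      map_one' := hext _ _ fun s => by simp [hU]
      map_mul' := fun g h => hext _ _ fun s => by simp [hU, mul_smul] }
  refine ⟨RKHS.OfKernel L, inferInstance, inferInstance, inferInstance,
    (Unitary.linearIsometryEquiv.symm.toMonoidHom).comp U', e, he, fun g s => ?_, hdense⟩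
  exact hU g s

/-! ### Positive semidefinite kernels and functions of positive type -/

theorem Matrix.PosSemidef.of_tendsto {ι κ : Type*} {l : Filter κ} [l.NeBot]
    {M : κ → Matrix ι ι ℂ} {N : Matrix ι ι ℂ} (hM : ∀ k, (M k).PosSemidef)
    (h : ∀ i j, Tendsto (fun k => M k i j) l (𝓝 (N i j))) : N.PosSemidef := by
  refine ⟨?_, fun x => ?_⟩
  · ext i j
    refine tendsto_nhds_unique ?_ (h i j)
    have h2 := (continuous_star.tendsto _).comp (h j i)
    refine h2.congr fun k => ?_
    exact (hM k).isHermitian.apply i j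
  · refine ge_of_tendsto' (f := fun k => x.sum fun i xi => x.sum fun j xj => star xi * M k i j * xj)
      (x := l) ?_ fun k => (hM k).2 x
    exact tendsto_finsetSum _ fun i _ => tendsto_finsetSum _ fun j _ =>
      ((h i j).const_mul _).mul_const _

theorem Matrix.posSemidef_of_star_mul {ι : Type*} (a : ι → ℂ) :
    (Matrix.of fun i j => star (a i) * a j).PosSemidef := by
  refine ⟨?_, fun x => ?_⟩
  · ext i j
    simp [mul_comm]
  · have : (x.sum fun i xi => x.sum fun j xj =>
        star xi * (Matrix.of fun i j => star (a i) * a j) i j * xj) =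
        star (x.sum fun i xi => a i * xi) * (x.sum fun i xi => a i * xi) := by
      simp only [Finsupp.sum, star_sum, Finset.sum_mul_sum, Matrix.of_apply]
      refine Finset.sum_congr rfl fun i _ => Finset.sum_congr rfl fun j _ => ?_
      simp only [star_mul]
      ring
    rw [this]
    exact star_mul_self_nonneg _

/-- A real function of positive type on a group. -/
def IsPositiveType {G : Type*} [Group G] (φ : G → ℝ) : Prop :=
  (Matrix.of fun g h : G => ((φ (g⁻¹ * h) : ℝ) : ℂ)).PosSemidef

namespace IsPositiveType

variable {G : Type u} [Group G]

theorem one : IsPositiveType (fun _ : G => 1) := by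
  simpa [IsPositiveType] using Matrix.posSemidef_of_star_mul (fun _ : G => (1 : ℂ))

theorem mul {φ ψ : G → ℝ} (hφ : IsPositiveType φ) (hψ : IsPositiveType ψ) :
    IsPositiveType (fun g => φ g * ψ g) := by
  have h := Matrix.PosSemidef.hadamard hφ hψ
  have h2 : (Matrix.of fun i j : G => ((φ (i⁻¹ * j) * ψ (i⁻¹ * j) : ℝ) : ℂ)) =
      Matrix.hadamard (Matrix.of fun i j : G => ((φ (i⁻¹ * j) : ℝ) : ℂ))
        (Matrix.of fun i j : G => ((ψ (i⁻¹ * j) : ℝ) : ℂ)) := by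
    ext i j
    simp
  rw [IsPositiveType, h2]
  exact h

theorem prod {ι : Type*} (s : Finset ι) {φ : ι → G → ℝ} (h : ∀ i, IsPositiveType (φ i)) :
    IsPositiveType (fun g => ∏ i ∈ s, φ i g) := by
  classical
  induction s using Finset.induction_on with
  | empty => simpa using one
  | insert i s hi ih => simpa [Finset.prod_insert hi] using (h i).mul ih

theorem inv {φ : G → ℝ} (h : IsPositiveType φ) (g : G) : φ g⁻¹ = φ g := by
  have h2 := h.isHermitian.apply 1 g
  simp only [Matrix.of_apply, inv_one, one_mul, mul_one] at h2
  simpa using congrArg Complex.re h2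

theorem pow {φ : G → ℝ} (h : IsPositiveType φ) (n : ℕ) : IsPositiveType (fun g => φ g ^ n) := by
  simpa using prod (Finset.range n) fun _ => h

theorem of_tendsto {κ : Type*} {l : Filter κ} [l.NeBot] {φ : κ → G → ℝ} {ψ : G → ℝ}
    (h : ∀ k, IsPositiveType (φ k)) (ht : ∀ g, Tendsto (fun k => φ k g) l (𝓝 (ψ g))) :
    IsPositiveType ψ :=
  Matrix.PosSemidef.of_tendsto h fun i j =>
    (Complex.continuous_ofReal.tendsto _).comp (ht (i⁻¹ * j))

/-- A normalized function of positive type varies little under translation by elements where it is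
close to `1`. -/
theorem abs_sub_le {φ : G → ℝ} (h : IsPositiveType φ) (h1 : φ 1 = 1) (g x k : G) :
    |φ (g * x * k) - φ x| ≤ √(2 * (1 - φ g)) + √(2 * (1 - φ k)) := by
  obtain ⟨H, _, _, _, π, e, he, -, -⟩ := exists_unitaryRepresentation_of_kernel.{u}
    (G := G) (Matrix.of fun g h : G => ((φ (g⁻¹ * h) : ℝ) : ℂ)) h (fun g s t => by simp [mul_assoc])
  have hn : ∀ s, ‖e s‖ = 1 := fun s => by
    have h2 := he s s
    simp only [Matrix.of_apply, inv_mul_cancel, h1] at h2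
    rw [norm_eq_sqrt_re_inner (𝕜 := ℂ), h2]
    simp
  have hd : ∀ s t, ‖e s - e t‖ = √(2 * (1 - φ (s⁻¹ * t))) := fun s t => by
    rw [← Real.sqrt_sq (norm_nonneg (e s - e t)), norm_sub_sq (𝕜 := ℂ), he, hn, hn]
    congr 1
    simp
    ring
  have key : ((φ (g * x * k) - φ x : ℝ) : ℂ) =
      inner ℂ (e g⁻¹ - e 1) (e (x * k)) + inner ℂ (e 1) (e (x * k) - e x) := by
    rw [inner_sub_left, inner_sub_right, he, he, he]
    simp [mul_assoc]
  have h3 : ‖((φ (g * x * k) - φ x : ℝ) : ℂ)‖ ≤ ‖e g⁻¹ - e 1‖ + ‖e (x * k) - e x‖ := by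
    rw [key]
    refine (norm_add_le _ _).trans (add_le_add ?_ ?_)
    · exact (norm_inner_le_norm _ _).trans_eq (by rw [hn, mul_one])
    · exact (norm_inner_le_norm _ _).trans_eq (by rw [hn, one_mul])
  rw [norm_sub_rev (e (x * k)), hd, hd, Complex.norm_real] at h3
  simpa using h3

end IsPositiveType

/-! ### Tails of infinite products -/

section TailProducts

variable {G : Type*}

/-- The infinite products `∏_{k ≥ m} ψ k` of functions with values in `[0, 1]`. -/
noncomputable def tailProd (ψ : ℕ → G → ℝ) (m : ℕ) (g : G) : ℝ :=
  ⨅ N : ℕ, ∏ k ∈ Finset.Ico m N, ψ k g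

variable {ψ : ℕ → G → ℝ}

theorem tendsto_tailProd (h0 : ∀ k g, 0 ≤ ψ k g) (h1 : ∀ k g, ψ k g ≤ 1) (m : ℕ) (g : G) :
    Tendsto (fun N => ∏ k ∈ Finset.Ico m N, ψ k g) atTop (𝓝 (tailProd ψ m g)) := by
  refine tendsto_atTop_ciInf (fun N N' hN => ?_) ⟨0, ?_⟩
  · exact Finset.prod_le_prod_of_subset_of_le_one (Finset.Ico_subset_Ico_right hN)
      (fun k _ => h0 k g) (fun k _ _ => h1 k g)
  · rintro _ ⟨N, rfl⟩
    exact Finset.prod_nonneg fun k _ => h0 k g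

theorem tailProd_nonneg (h0 : ∀ k g, 0 ≤ ψ k g) (m : ℕ) (g : G) : 0 ≤ tailProd ψ m g :=
  Real.iInf_nonneg fun _ => Finset.prod_nonneg fun k _ => h0 k g

theorem tailProd_le (h0 : ∀ k g, 0 ≤ ψ k g) (h1 : ∀ k g, ψ k g ≤ 1) {m k : ℕ} (hk : m ≤ k)
    (g : G) : tailProd ψ m g ≤ ψ k g := by
  refine (ciInf_le ⟨0, ?_⟩ (k + 1)).trans ?_
  · rintro _ ⟨N, rfl⟩
    exact Finset.prod_nonneg fun k _ => h0 k g
  · rw [Finset.prod_Ico_succ_top hk]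
    exact mul_le_of_le_one_left (h0 k g) (Finset.prod_le_one (fun k _ => h0 k g) fun k _ => h1 k g)

theorem one_sub_sum_le_prod {ι : Type*} (s : Finset ι) {a : ι → ℝ} (h0 : ∀ i, 0 ≤ a i)
    (h1 : ∀ i, a i ≤ 1) : 1 - ∑ i ∈ s, (1 - a i) ≤ ∏ i ∈ s, a i := by
  classical
  induction s using Finset.induction_on with
  | empty => simp
  | insert i s hi ih =>
    rw [Finset.sum_insert hi, Finset.prod_insert hi]
    have := Finset.prod_le_one (s := s) (fun k _ => h0 k) fun k _ => h1 k
    nlinarith [h0 i, h1 i]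

theorem tendsto_tailProd_one (h0 : ∀ k g, 0 ≤ ψ k g) (h1 : ∀ k g, ψ k g ≤ 1) {g : G}
    (hs : Summable fun k => 1 - ψ k g) :
    Tendsto (fun m => tailProd ψ m g) atTop (𝓝 1) := by
  have h := (tendsto_sum_nat_add fun k => 1 - ψ k g).const_sub 1
  rw [sub_zero] at h
  refine tendsto_of_tendsto_of_tendsto_of_le_of_le h tendsto_const_nhds (fun m => ?_)
    fun m => (tailProd_le h0 h1 le_rfl g).trans (h1 m g)
  refine le_ciInf fun N => le_trans ?_ (one_sub_sum_le_prod _ (fun k => h0 k g) fun k => h1 k g)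
  rw [Finset.sum_Ico_eq_sum_range]
  have := ((summable_nat_add_iff m).2 hs).sum_le_tsum (Finset.range (N - m))
    (fun k _ => sub_nonneg.2 (h1 (k + m) g))
  simp only [add_comm m]
  linarith

end TailProducts

/-! ### Representations with prescribed decay of coefficients -/

theorem isClosed_setOf_tendsto_zero {E G : Type*} [SeminormedAddCommGroup E] {l : Filter G}
    {F : G → E → ℂ} {C : ℝ} (hF : ∀ g x y, ‖F g x - F g y‖ ≤ C * ‖x - y‖) :
    IsClosed {x | Tendsto (fun g => F g x) l (𝓝 0)} := by
  refine isClosed_of_closure_subset fun x hx => ?_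
  rw [Set.mem_ofPred_eq, Metric.tendsto_nhds]
  intro ε hε
  have hC : 0 < |C| + 1 := by positivity
  obtain ⟨y, hy, hxy⟩ := Metric.mem_closure_iff.1 hx (ε / 2 / (|C| + 1)) (by positivity)
  filter_upwards [Metric.tendsto_nhds.1 hy (ε / 2) (by positivity)] with g hg
  rw [dist_zero_right] at hg ⊢
  rw [dist_eq_norm, lt_div_iff₀ hC] at hxy
  have h1 := norm_le_norm_add_norm_sub' (F g x) (F g y)
  have h2 := hF g x y
  have h3 : C * ‖x - y‖ ≤ (|C| + 1) * ‖x - y‖ :=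
    mul_le_mul_of_nonneg_right ((le_abs_self C).trans (by linarith)) (norm_nonneg _)
  linarith

/-- Coefficients are Lipschitz in each vector uniformly in `g`, so decay passes to the closed span,
one variable at a time. -/
theorem tendsto_inner_zero_of_denseRange {G S H : Type*} [Group G] [NormedAddCommGroup H]
    [InnerProductSpace ℂ H] [CompleteSpace H] (π : G →* unitary (H →L[ℂ] H)) {e : S → H}
    (hdense : DenseRange (Finsupp.linearCombination ℂ e)) {l : Filter G}
    (h : ∀ s t, Tendsto (fun g => inner ℂ ((π g : H →L[ℂ] H) (e s)) (e t)) l (𝓝 0)) (ξ η : H) :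
    Tendsto (fun g => inner ℂ ((π g : H →L[ℂ] H) ξ) η) l (𝓝 0) := by
  have h1 : ∀ (s : S) (η : H), Tendsto (fun g => inner ℂ ((π g : H →L[ℂ] H) (e s)) η) l (𝓝 0) := by
    intro s η
    refine hdense.induction_on (p := fun η => Tendsto (fun g => inner ℂ ((π g : H →L[ℂ] H) (e s)) η)
      l (𝓝 0)) η (isClosed_setOf_tendsto_zero (C := ‖e s‖) fun g x y => ?_) fun x => ?_
    · rw [← inner_sub_right]
      exact (norm_inner_le_norm _ _).trans_eq (by rw [Unitary.norm_map])
    · simp only [Finsupp.linearCombination_apply, Finsupp.sum, inner_sum, inner_smul_right]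
      simpa using tendsto_finsetSum x.support fun t _ => (h s t).const_mul (x t)
  refine hdense.induction_on (p := fun ξ => Tendsto (fun g => inner ℂ ((π g : H →L[ℂ] H) ξ) η)
    l (𝓝 0)) ξ (isClosed_setOf_tendsto_zero (C := ‖η‖) fun g x y => ?_) fun x => ?_
  · rw [← inner_sub_left, ← map_sub, mul_comm]
    exact (norm_inner_le_norm _ _).trans_eq (by rw [Unitary.norm_map])
  · simp only [Finsupp.linearCombination_apply, Finsupp.sum, sum_inner, inner_smul_left, map_sum,
      map_smul]
    simpa using tendsto_finsetSum x.support fun t _ => (h1 t η).const_mul (starRingEnd ℂ (x t))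

/-- Functions `Φ m` of positive type converging to `1` give a unitary representation with almost
invariant vectors, whose matrix coefficients tend to `0` along every filter along which all
two-sided translates of the `Φ m` do. -/
theorem exists_unitaryRepresentation_of_isPositiveType {G : Type*} [Group G] [Countable G]
    {Φ : ℕ → G → ℝ} (hΦ : ∀ m, IsPositiveType (Φ m)) (hone : ∀ m, Φ m 1 = 1)
    (hlim : ∀ g, Tendsto (fun m => Φ m g) atTop (𝓝 1)) :
    ∃ (H : Type v) (_ : NormedAddCommGroup H) (_ : InnerProductSpace ℂ H) (_ : CompleteSpace H)
      (π : G →* unitary (H →L[ℂ] H)), CountableGroup.HasAlmostInvariantVectors π ∧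
      ∀ l : Filter G, (∀ m g h, Tendsto (fun x => Φ m (g * x * h)) l (𝓝 0)) →
        ∀ ξ η : H, Tendsto (fun g => inner ℂ ((π g : H →L[ℂ] H) ξ) η) l (𝓝 0) := by
  classical
  let _ : MulAction G (ℕ × G) :=
    { smul := fun g s => (s.1, g * s.2)
      one_smul := fun s => Prod.ext rfl (one_mul _)
      mul_smul := fun g h s => Prod.ext rfl (mul_assoc _ _ _) }
  have hsmul : ∀ (g : G) (s : ℕ × G), g • s = (s.1, g * s.2) := fun _ _ => rfl
  -- A block-diagonal kernel, whose representation is the direct sum over `m` of the GNS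
  -- representations of the `Φ m`.
  let K : Matrix (ℕ × G) (ℕ × G) ℂ :=
    Matrix.of fun s t => if s.1 = t.1 then ((Φ s.1 (s.2⁻¹ * t.2) : ℝ) : ℂ) else 0
  have hK : K.PosSemidef := by
    -- The `k`-th block is a Schur product with the rank-one kernel of an indicator function; each
    -- entry of the partial sums is eventually constant.
    let M : ℕ → Matrix (ℕ × G) (ℕ × G) ℂ := fun k => Matrix.hadamard
      ((Matrix.of fun g h : G => ((Φ k (g⁻¹ * h) : ℝ) : ℂ)).submatrix Prod.snd Prod.snd)
      (Matrix.of fun s t : ℕ × G =>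
        star (if s.1 = k then (1 : ℂ) else 0) * if t.1 = k then (1 : ℂ) else 0)
    have hM : ∀ k, (M k).PosSemidef := fun k =>
      ((hΦ k).submatrix Prod.snd).hadamard (Matrix.posSemidef_of_star_mul _)
    refine Matrix.PosSemidef.of_tendsto (l := atTop)
      (M := fun N => ∑ k ∈ Finset.range N, M k)
      (fun N => Matrix.posSemidef_sum _ fun k _ => hM k) fun s t => ?_
    refine tendsto_const_nhds.congr' ?_
    filter_upwards [eventually_gt_atTop s.1] with N hN
    rw [Matrix.sum_apply, Finset.sum_eq_single s.1]
    · by_cases hst : s.1 = t.1 <;> simp [K, M, hst, eq_comm]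
    · intro k _ hk
      simp [M, hk.symm]
    · intro hs
      exact absurd (Finset.mem_range.2 hN) hs
  obtain ⟨H, i1, i2, i3, π, e, he, hπ, hdense⟩ := exists_unitaryRepresentation_of_kernel.{v} (G := G) K hK
    fun g s t => by simp [K, hsmul, mul_assoc]
  refine ⟨H, i1, i2, i3, π, ?_, fun l hl => tendsto_inner_zero_of_denseRange π hdense ?_⟩
  · intro ε hε F
    have hn : ∀ s, ‖e s‖ = 1 := fun s => by
      have h2 := he s s
      simp only [K, Matrix.of_apply, inv_mul_cancel, hone, if_true] at h2
      rw [norm_eq_sqrt_re_inner (𝕜 := ℂ), h2]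
      simp
    have hev : ∀ᶠ m in atTop, ∀ g ∈ F, 1 - ε ^ 2 / 2 < Φ m g⁻¹ := by
      rw [eventually_all_finset]
      intro g _
      exact (hlim g⁻¹).eventually_const_lt (by nlinarith [sq_pos_of_pos hε])
    obtain ⟨m, hm⟩ := hev.exists
    refine ⟨e (m, 1), hn _, fun g hg => ?_⟩
    refine (sq_le_sq₀ (norm_nonneg _) hε.le).1 ?_
    rw [norm_sub_sq (𝕜 := ℂ), hπ, he, hn, hn]
    have := hm g hg
    simp only [hsmul, K, Matrix.of_apply, if_true, mul_one, RCLike.re_to_complex,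
      Complex.ofReal_re]
    linarith
  · intro s t
    simp only [hπ, he, hsmul, K, Matrix.of_apply, mul_inv_rev]
    by_cases hst : s.1 = t.1
    · simp only [hst, if_true]
      refine (Complex.continuous_ofReal.tendsto' 0 0 Complex.ofReal_zero).comp ?_
      refine (hl t.1 t.2⁻¹ s.2).congr fun g => ?_
      rw [← (hΦ t.1).inv]
      simp [mul_assoc]
    · simp [hst, tendsto_const_nhds]

/-! ### Haagerup property and relative property (T) through functions of positive type -/

section Criteria

variable {G : Type*} [Group G] [Countable G] {φ : ℕ → G → ℝ}

/-- From normalized functions of positive type converging to `1` one extracts a subsequence whose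
powers have convergent infinite products, again of positive type and with tails converging to `1`. -/
theorem exists_subseq_tailProd (hφ : ∀ n, IsPositiveType (φ n)) (h0 : ∀ n g, 0 ≤ φ n g)
    (h1 : ∀ n g, φ n g ≤ 1) (hone : ∀ n, φ n 1 = 1)
    (hlim : ∀ g, Tendsto (fun n => φ n g) atTop (𝓝 1)) :
    ∃ (n : ℕ → ℕ) (Φ : ℕ → G → ℝ), StrictMono n ∧ (∀ m, IsPositiveType (Φ m)) ∧
      (∀ m, Φ m 1 = 1) ∧ (∀ g, Tendsto (fun m => Φ m g) atTop (𝓝 1)) ∧ (∀ m g, 0 ≤ Φ m g) ∧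
      ∀ m k g, m ≤ k → Φ m g ≤ φ (n k) g ^ k := by
  obtain ⟨f, hf⟩ := exists_surjective_nat G
  -- Stage `k` treats only the first `k + 1` elements of the enumeration, so `f i` satisfies the
  -- geometric bound from stage `i` on.
  have hev : ∀ k : ℕ, ∀ᶠ n in atTop, ∀ i ∈ Finset.range (k + 1),
      1 - φ n (f i) ^ k < (1 / 2) ^ k := fun k => by
    rw [eventually_all_finset]
    intro i _
    have h := ((hlim (f i)).pow k).const_sub 1
    rw [one_pow, sub_self] at h
    exact h.eventually_lt_const (by positivity)
  obtain ⟨n, hn, hn2⟩ := extraction_forall_of_eventually hev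
  have h0' : ∀ k g, 0 ≤ φ (n k) g ^ k := fun k g => pow_nonneg (h0 _ _) _
  have h1' : ∀ k g, φ (n k) g ^ k ≤ 1 := fun k g => pow_le_one₀ (h0 _ _) (h1 _ _)
  refine ⟨n, tailProd fun k g => φ (n k) g ^ k, hn, fun m => ?_, fun m => ?_, fun g => ?_,
    tailProd_nonneg h0', fun m k g hk => tailProd_le h0' h1' hk g⟩
  · exact IsPositiveType.of_tendsto (fun N => IsPositiveType.prod (Finset.Ico m N)
      (φ := fun k g => φ (n k) g ^ k) fun k => (hφ _).pow k) (tendsto_tailProd h0' h1' m)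
  · simp [tailProd, hone]
  · refine tendsto_tailProd_one h0' h1' ?_
    obtain ⟨i, rfl⟩ := hf g
    refine (summable_nat_add_iff i).1 (Summable.of_nonneg_of_le
      (fun k => sub_nonneg.2 (h1' (k + i) _)) (fun k => (hn2 (k + i) i (by simp)).le) ?_)
    exact (summable_nat_add_iff i).2 summable_geometric_two

/-- Off a finite set depending on `k`, `Φ m` is at most the `k`-th power of `max c 0`. As `k` is
arbitrary, every `Φ m` vanishes at infinity. -/
theorem isHaagerup_of_isPositiveType (hφ : ∀ n, IsPositiveType (φ n)) (h0 : ∀ n g, 0 ≤ φ n g)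
    (h1 : ∀ n g, φ n g ≤ 1) (hone : ∀ n, φ n 1 = 1)
    (hlim : ∀ g, Tendsto (fun n => φ n g) atTop (𝓝 1)) {c : ℝ} (hc : c < 1)
    (hfar : ∀ n, ∀ᶠ g in cofinite, φ n g ≤ c) : CountableGroup.IsHaagerup.{v} G := by
  obtain ⟨n, Φ, -, hΦ, hΦ1, hΦlim, hΦ0, hle⟩ := exists_subseq_tailProd hφ h0 h1 hone hlim
  obtain ⟨H, i1, i2, i3, π, hai, hπ⟩ :=
    exists_unitaryRepresentation_of_isPositiveType.{v} hΦ hΦ1 hΦlim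
  refine ⟨H, i1, i2, i3, π, hπ cofinite fun m g h => ?_, hai⟩
  have hinj : Function.Injective fun x => g * x * h := fun x y hxy => by simpa using hxy
  refine Tendsto.comp (g := Φ m) ?_ hinj.tendsto_cofinite
  have hc' : max c 0 < 1 := max_lt hc one_pos
  rw [Metric.tendsto_nhds]
  intro ε hε
  have hpow := (tendsto_pow_atTop_nhds_zero_of_lt_one (le_max_right c 0) hc').eventually_lt_const hε
  obtain ⟨k, hk, hmk⟩ := (hpow.and (eventually_ge_atTop m)).exists
  filter_upwards [hfar (n k)] with x hx
  rw [Real.dist_0_eq_abs, abs_of_nonneg (hΦ0 m x)]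
  exact ((hle m k x hmk).trans
    (pow_le_pow_left₀ (h0 _ _) (hx.trans (le_max_left _ _)) k)).trans_lt hk

/-- Otherwise there are `x n ∈ X` with `φ n (x n) ≤ c`. The product construction gives almost
invariant vectors while all coefficients tend to `0` along `x (n k)`, so no unit vector can be
almost fixed by `X`. -/
theorem CountableGroup.HasRelativePropertyT.exists_forall_lt {X : Set G}
    (hX : CountableGroup.HasRelativePropertyT.{v} X)
    (hφ : ∀ n, IsPositiveType (φ n)) (h0 : ∀ n g, 0 ≤ φ n g)
    (h1 : ∀ n g, φ n g ≤ 1) (hone : ∀ n, φ n 1 = 1)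
    (hlim : ∀ g, Tendsto (fun n => φ n g) atTop (𝓝 1)) {c : ℝ} (hc : c < 1) :
    ∃ n, ∀ x ∈ X, c < φ n x := by
  by_contra! hcon
  choose x hxX hx using hcon
  obtain ⟨n, Φ, hn, hΦ, hΦ1, hΦlim, hΦ0, hle⟩ := exists_subseq_tailProd hφ h0 h1 hone hlim
  obtain ⟨H, i1, i2, i3, π, hai, hπ⟩ :=
    exists_unitaryRepresentation_of_isPositiveType.{v} hΦ hΦ1 hΦlim
  -- Displacement at most `1` forces the real part of the coefficient to be at least `1 / 2` on `X`.
  obtain ⟨ξ, hξ, hξX⟩ := hX H π hai 1 one_pos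
  have hzero := hπ (map (fun k => x (n k)) atTop) (fun m g h => ?_) ξ ξ
  · rw [tendsto_map'_iff] at hzero
    obtain ⟨k, hk⟩ := ((Metric.tendsto_nhds.1 hzero) (1 / 2) (by norm_num)).exists
    rw [dist_zero_right] at hk
    have h2 := hξX _ (hxX (n k))
    have h3 := norm_sub_sq (𝕜 := ℂ) ((π (x (n k)) : H →L[ℂ] H) ξ) ξ
    rw [Unitary.norm_map, hξ] at h3
    have h4 := RCLike.re_le_norm (inner ℂ ((π (x (n k)) : H →L[ℂ] H) ξ) ξ)
    have h5 : ‖(π (x (n k)) : H →L[ℂ] H) ξ - ξ‖ ^ 2 ≤ 1 := pow_le_one₀ (norm_nonneg _) h2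
    simp only [Function.comp_apply] at hk
    linarith
  · rw [tendsto_map'_iff]
    -- The midpoint of `c` and `1` leaves room `(1 - c) / 2` for the error of two-sided translation
    -- by fixed `g` and `h`.
    set d := max ((1 + c) / 2) 0
    have hd : d < 1 := max_lt (by linarith) one_pos
    refine squeeze_zero' (.of_forall fun k => hΦ0 _ _) ?_
      (tendsto_pow_atTop_nhds_zero_of_lt_one (le_max_right ((1 + c) / 2) 0) hd)
    have hs : Tendsto (fun k => √(2 * (1 - φ (n k) g)) + √(2 * (1 - φ (n k) h))) atTop (𝓝 0) := by
      have hs1 : ∀ g, Tendsto (fun k => √(2 * (1 - φ (n k) g))) atTop (𝓝 0) := fun g => by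
        have := ((((hlim g).comp hn.tendsto_atTop).const_sub 1).const_mul 2).sqrt
        simpa using this
      simpa using (hs1 g).add (hs1 h)
    filter_upwards [eventually_ge_atTop m,
      hs.eventually_lt_const (show 0 < (1 - c) / 2 by linarith)] with k hmk hk
    refine (hle m k _ hmk).trans (pow_le_pow_left₀ (h0 _ _) (le_trans ?_ (le_max_left _ _)) k)
    have h2 := (le_abs_self _).trans ((hφ (n k)).abs_sub_le (hone _) g (x (n k)) h)
    have h3 := hx (n k)
    linarith

end Criteria

/-! ### Affinity of vector states on an operator algebra -/

section Affinity

variable {H : Type*} [NormedAddCommGroup H] [InnerProductSpace ℂ H]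

theorem re_inner_nonneg_of_nonneg {T : H →L[ℂ] H} (hT : 0 ≤ T) (ξ : H) :
    0 ≤ (inner ℂ (T ξ) ξ).re :=
  ((ContinuousLinearMap.nonneg_iff_isPositive T).1 hT).re_inner_nonneg_left ξ

/-- A finite partition of unity into positive operators belonging to a given algebra. -/
structure OperatorPartition (D : Subalgebra ℂ (H →L[ℂ] H)) where
  /-- The index set. -/
  ι : Type
  [fintype : Fintype ι]
  /-- The members of the partition. -/
  f : ι → H →L[ℂ] H
  mem : ∀ i, f i ∈ D
  nonneg : ∀ i, 0 ≤ f i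
  sum_eq_one : ∑ i, f i = 1

/-- Cauchy–Schwarz for the form of `T`, written through its square root. -/
theorem re_inner_le_sqrt_mul_sqrt [CompleteSpace H] {T : H →L[ℂ] H} (hT : 0 ≤ T) (ξ η : H) :
    (inner ℂ (T ξ) η).re ≤ √(inner ℂ (T ξ) ξ).re * √(inner ℂ (T η) η).re := by
  have hsa : IsSelfAdjoint (CFC.sqrt T) := (CFC.sqrt_nonneg T).isSelfAdjoint
  have h : ∀ ξ η : H, inner ℂ (T ξ) η = inner ℂ (CFC.sqrt T ξ) (CFC.sqrt T η) := fun ξ η => by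
    conv_lhs => rw [← CFC.sqrt_mul_sqrt_self T hT]
    exact hsa.isSymmetric _ _
  have h2 : ∀ ξ : H, √(inner ℂ (T ξ) ξ).re = ‖CFC.sqrt T ξ‖ := fun ξ => by
    rw [h, norm_eq_sqrt_re_inner (𝕜 := ℂ)]
    rfl
  rw [h2, h2, h]
  exact re_inner_le_norm (𝕜 := ℂ) _ _

namespace OperatorPartition

attribute [instance] OperatorPartition.fintype

variable {D : Subalgebra ℂ (H →L[ℂ] H)}

/-- The Bhattacharyya coefficient of two vector states with respect to a partition. -/
noncomputable def coeff (P : OperatorPartition D) (ξ η : H) : ℝ :=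
  ∑ i, √(inner ℂ (P.f i ξ) ξ).re * √(inner ℂ (P.f i η) η).re

theorem coeff_nonneg (P : OperatorPartition D) (ξ η : H) : 0 ≤ P.coeff ξ η :=
  Finset.sum_nonneg fun _ _ => by positivity

theorem sum_re_inner (P : OperatorPartition D) (ξ η : H) :
    ∑ i, (inner ℂ (P.f i ξ) η).re = (inner ℂ ξ η).re := by
  rw [← Complex.re_sum, ← sum_inner, ← sum_apply, P.sum_eq_one, one_apply_eq_self]

/-- Partitions are preordered by the size of their Bhattacharyya coefficients, so that finer
partitions are larger. -/
noncomputable instance : Preorder (OperatorPartition D) :=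
  Preorder.lift fun P => OrderDual.toDual P.coeff

theorem le_iff {P Q : OperatorPartition D} : P ≤ Q ↔ ∀ ξ η, Q.coeff ξ η ≤ P.coeff ξ η := Iff.rfl

theorem coeff_le (P : OperatorPartition D) (ξ η : H) : P.coeff ξ η ≤ ‖ξ‖ * ‖η‖ := by
  refine (Real.sum_sqrt_mul_sqrt_le _ (fun i => re_inner_nonneg_of_nonneg (P.nonneg i) ξ)
    fun i => re_inner_nonneg_of_nonneg (P.nonneg i) η).trans_eq ?_
  rw [P.sum_re_inner, P.sum_re_inner, norm_eq_sqrt_re_inner (𝕜 := ℂ) ξ,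
    norm_eq_sqrt_re_inner (𝕜 := ℂ) η]
  rfl

variable [CompleteSpace H]

theorem re_inner_le_coeff (P : OperatorPartition D) (ξ η : H) :
    (inner ℂ ξ η).re ≤ P.coeff ξ η := by
  rw [← P.sum_re_inner]
  exact Finset.sum_le_sum fun i _ => re_inner_le_sqrt_mul_sqrt (P.nonneg i) ξ η

/-- The trivial partition. -/
def trivial (D : Subalgebra ℂ (H →L[ℂ] H)) : OperatorPartition D where
  ι := Unit
  f := fun _ => 1
  mem := fun _ => one_mem D
  nonneg := fun _ => zero_le_one
  sum_eq_one := by simp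

instance : Nonempty (OperatorPartition D) := ⟨trivial D⟩

/-- The two-element partition defined by an operator `0 ≤ T ≤ 1`. -/
def pair {T : H →L[ℂ] H} (hD : T ∈ D) (h0 : 0 ≤ T) (h1 : T ≤ 1) : OperatorPartition D where
  ι := Bool
  f := fun b => bif b then T else 1 - T
  mem := fun b => by cases b <;> simp [hD, sub_mem, one_mem]
  nonneg := fun b => by cases b <;> simp [h0, h1]
  sum_eq_one := by simp

/-- The common refinement of two partitions in a commutative algebra. -/
def mul (hD : ∀ a ∈ D, ∀ b ∈ D, Commute a b) (P Q : OperatorPartition D) :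
    OperatorPartition D where
  ι := P.ι × Q.ι
  f := fun i => P.f i.1 * Q.f i.2
  mem := fun i => mul_mem (P.mem _) (Q.mem _)
  nonneg := fun i => Commute.mul_nonneg (P.nonneg _) (Q.nonneg _) (hD _ (P.mem _) _ (Q.mem _))
  sum_eq_one := by
    rw [Fintype.sum_prod_type, ← Fintype.sum_mul_sum, P.sum_eq_one, Q.sum_eq_one, one_mul]

/-- Cauchy–Schwarz over the pieces into which `Q` cuts each `P.f i` shows that refining lowers the
coefficient. -/
theorem le_mul_left (hD : ∀ a ∈ D, ∀ b ∈ D, Commute a b) (P Q : OperatorPartition D) :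
    P ≤ mul hD P Q := by
  rw [le_iff]
  intro ξ η
  have hsum : ∀ i ξ, ∑ j, (inner ℂ ((P.f i * Q.f j) ξ) ξ).re = (inner ℂ (P.f i ξ) ξ).re := by
    intro i ξ
    rw [← Complex.re_sum, ← sum_inner, ← sum_apply, ← Finset.mul_sum, Q.sum_eq_one, mul_one]
  refine (Fintype.sum_prod_type _).trans_le (Finset.sum_le_sum fun i _ => ?_)
  refine (Real.sum_sqrt_mul_sqrt_le _
    (fun j => re_inner_nonneg_of_nonneg ((mul hD P Q).nonneg (i, j)) ξ)
    fun j => re_inner_nonneg_of_nonneg ((mul hD P Q).nonneg (i, j)) η).trans_eq ?_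
  simp only [mul, hsum]

theorem mul_comm_le (hD : ∀ a ∈ D, ∀ b ∈ D, Commute a b) (P Q : OperatorPartition D) :
    mul hD Q P ≤ mul hD P Q := by
  rw [le_iff]
  intro ξ η
  refine (Fintype.sum_equiv (Equiv.prodComm P.ι Q.ι) _ _ fun i => ?_).le
  simp only [mul, (hD _ (P.mem i.1) _ (Q.mem i.2)).eq, Equiv.prodComm_apply, Prod.fst_swap,
    Prod.snd_swap]

theorem isDirectedOrder (hD : ∀ a ∈ D, ∀ b ∈ D, Commute a b) :
    IsDirectedOrder (OperatorPartition D) :=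
  ⟨fun P Q => ⟨mul hD P Q, le_mul_left hD P Q,
    (le_mul_left hD Q P).trans (mul_comm_le hD P Q)⟩⟩

/-- The image of a partition under conjugation by a unitary normalizing the algebra. -/
noncomputable def conj (P : OperatorPartition D) (U : unitary (H →L[ℂ] H))
    (hU : ∀ T ∈ D, star (U : H →L[ℂ] H) * T * U ∈ D) : OperatorPartition D where
  ι := P.ι
  f := fun i => star (U : H →L[ℂ] H) * P.f i * U
  mem := fun i => hU _ (P.mem i)
  nonneg := fun i => star_left_conjugate_nonneg (P.nonneg i) _
  sum_eq_one := by
    rw [← Finset.sum_mul, ← Finset.mul_sum, P.sum_eq_one, mul_one, Unitary.coe_star_mul_self]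

theorem coeff_conj (P : OperatorPartition D) (U : unitary (H →L[ℂ] H))
    (hU : ∀ T ∈ D, star (U : H →L[ℂ] H) * T * U ∈ D) (ξ η : H) :
    (P.conj U hU).coeff ξ η = P.coeff ((U : H →L[ℂ] H) ξ) ((U : H →L[ℂ] H) η) := by
  simp only [coeff, conj, ContinuousLinearMap.star_eq_adjoint, mul_apply_eq_comp,
    ContinuousLinearMap.adjoint_inner_left]
  rfl

end OperatorPartition

/-- The affinity (fidelity) of two vector states on an algebra of operators: the infimum of the
Bhattacharyya coefficients over all partitions. -/
noncomputable def affinity (D : Subalgebra ℂ (H →L[ℂ] H)) (ξ η : H) : ℝ :=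
  ⨅ P : OperatorPartition D, P.coeff ξ η

section

variable {D : Subalgebra ℂ (H →L[ℂ] H)}

theorem bddBelow_range_coeff (ξ η : H) :
    BddBelow (Set.range fun P : OperatorPartition D => P.coeff ξ η) :=
  ⟨0, by rintro _ ⟨P, rfl⟩; exact P.coeff_nonneg ξ η⟩

theorem affinity_nonneg (ξ η : H) : 0 ≤ affinity D ξ η :=
  Real.iInf_nonneg fun P => P.coeff_nonneg ξ η

theorem affinity_le_coeff (P : OperatorPartition D) (ξ η : H) : affinity D ξ η ≤ P.coeff ξ η :=
  ciInf_le (bddBelow_range_coeff ξ η) P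

variable [CompleteSpace H]

theorem re_inner_le_affinity (ξ η : H) : (inner ℂ ξ η).re ≤ affinity D ξ η :=
  le_ciInf fun P => P.re_inner_le_coeff ξ η

theorem affinity_le (ξ η : H) : affinity D ξ η ≤ ‖ξ‖ * ‖η‖ :=
  (affinity_le_coeff (.trivial D) ξ η).trans (OperatorPartition.coeff_le _ ξ η)

theorem affinity_self (ξ : H) : affinity D ξ ξ = ‖ξ‖ ^ 2 := by
  refine le_antisymm ((affinity_le ξ ξ).trans_eq (sq _).symm) ?_
  have h := re_inner_le_affinity (D := D) ξ ξ
  rwa [inner_self_eq_norm_sq_to_K, ← RCLike.ofReal_pow, RCLike.ofReal_eq_complex_ofReal,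
    Complex.ofReal_re] at h

theorem affinity_unitary (U : unitary (H →L[ℂ] H))
    (hU : ∀ T ∈ D, star (U : H →L[ℂ] H) * T * U ∈ D)
    (hU' : ∀ T ∈ D, (U : H →L[ℂ] H) * T * star (U : H →L[ℂ] H) ∈ D) (ξ η : H) :
    affinity D ((U : H →L[ℂ] H) ξ) ((U : H →L[ℂ] H) η) = affinity D ξ η := by
  have key : ∀ (V : unitary (H →L[ℂ] H)), (∀ T ∈ D, star (V : H →L[ℂ] H) * T * V ∈ D) →
      ∀ ξ η, affinity D ξ η ≤ affinity D ((V : H →L[ℂ] H) ξ) ((V : H →L[ℂ] H) η) :=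
    fun V hV ξ η => le_ciInf fun P => (affinity_le_coeff (P.conj V hV) ξ η).trans_eq
      (P.coeff_conj V hV ξ η)
  refine le_antisymm ((key (star U) (by simpa using hU') _ _).trans_eq ?_) (key U hU ξ η)
  simp only [← mul_apply_eq_comp, Unitary.coe_star, Unitary.coe_star_mul_self,
    one_apply_eq_self]

theorem affinity_unitary_right (U : unitary (H →L[ℂ] H))
    (hU : ∀ T ∈ D, Commute (U : H →L[ℂ] H) T) (ξ η : H) :
    affinity D ξ ((U : H →L[ℂ] H) η) = affinity D ξ η := by
  refine iInf_congr fun P => Finset.sum_congr rfl fun i _ => ?_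
  rw [← mul_apply_eq_comp, ← (hU _ (P.mem i)).eq, mul_apply_eq_comp,
    Unitary.inner_map_map]

/-- For one partition the coefficient is a sum of rank-one kernels. Commutativity gives common
refinements, so the infimum is a limit along a directed set, which preserves positivity. -/
theorem posSemidef_affinity (hD : ∀ a ∈ D, ∀ b ∈ D, Commute a b) {S : Type*} (e : S → H) :
    (Matrix.of fun s t : S => ((affinity D (e s) (e t) : ℝ) : ℂ)).PosSemidef := by
  have := OperatorPartition.isDirectedOrder hD
  refine Matrix.PosSemidef.of_tendsto (l := (atTop : Filter (OperatorPartition D)))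
    (M := fun P => ∑ i, Matrix.of fun s t : S =>
      star ((√(inner ℂ (P.f i (e s)) (e s)).re : ℝ) : ℂ) *
        ((√(inner ℂ (P.f i (e t)) (e t)).re : ℝ) : ℂ))
    (fun P => Matrix.posSemidef_sum _ fun i _ => Matrix.posSemidef_of_star_mul _) fun s t => ?_
  have h := tendsto_atTop_ciInf (f := fun P : OperatorPartition D => P.coeff (e s) (e t))
    (fun P Q hPQ => hPQ _ _) (bddBelow_range_coeff _ _)
  refine ((Complex.continuous_ofReal.tendsto _).comp h).congr fun P => ?_
  simp [OperatorPartition.coeff, Matrix.sum_apply]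

/-- Testing on the partition `T`, `1 - T` reduces this to comparing Hellinger distance with total
variation on two points. -/
theorem sq_sub_le_one_sub_affinity {T : H →L[ℂ] H} (hD : T ∈ D) (h0 : 0 ≤ T) (h1 : T ≤ 1)
    {ξ η : H} (hξ : ‖ξ‖ = 1) (hη : ‖η‖ = 1) :
    ((inner ℂ (T ξ) ξ).re - (inner ℂ (T η) η).re) ^ 2 / 4 ≤ 1 - affinity D ξ η := by
  have h := affinity_le_coeff (.pair hD h0 h1) ξ η
  have hone : ∀ ξ : H, ‖ξ‖ = 1 → (inner ℂ ξ ξ).re = 1 := fun ξ hξ => by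
    rw [inner_self_eq_norm_sq_to_K, hξ]; simp
  have hT : ∀ ξ : H, ‖ξ‖ = 1 → (inner ℂ ((1 - T) ξ) ξ).re = 1 - (inner ℂ (T ξ) ξ).re :=
    fun ξ hξ => by
      rw [sub_apply, inner_sub_left, Complex.sub_re,
        one_apply_eq_self, hone ξ hξ]
  have hle : ∀ ξ : H, ‖ξ‖ = 1 → (inner ℂ (T ξ) ξ).re ≤ 1 := fun ξ hξ => by
    have := re_inner_nonneg_of_nonneg (sub_nonneg.2 h1) ξ
    rw [hT ξ hξ] at this
    linarith
  have hcoeff : (OperatorPartition.pair hD h0 h1).coeff ξ η =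
      √(inner ℂ (T ξ) ξ).re * √(inner ℂ (T η) η).re +
        √(1 - (inner ℂ (T ξ) ξ).re) * √(1 - (inner ℂ (T η) η).re) := by
    rw [← hT ξ hξ, ← hT η hη]
    exact Fintype.sum_bool _
  rw [hcoeff] at h
  -- Since `√p + √q ≤ 2`, the difference `p - q` is at most twice that of the roots; this is applied
  -- to `p`, `q` and to their complements.
  have key : ∀ p q : ℝ, 0 ≤ p → p ≤ 1 → 0 ≤ q → q ≤ 1 → (p - q) ^ 2 ≤ 4 * (√p - √q) ^ 2 := by
    intro p q hp hp1 hq hq1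
    have e1 := Real.sq_sqrt hp
    have e2 := Real.sq_sqrt hq
    have h3 : (√p + √q) ^ 2 ≤ 2 ^ 2 := by
      refine pow_le_pow_left₀ (by positivity) ?_ 2
      linarith [Real.sqrt_le_one.2 hp1, Real.sqrt_le_one.2 hq1]
    have h4 : p - q = (√p - √q) * (√p + √q) := by linear_combination e2 - e1
    rw [h4, mul_pow]
    nlinarith [sq_nonneg (√p - √q)]
  have a0 := re_inner_nonneg_of_nonneg h0 ξ
  have b0 := re_inner_nonneg_of_nonneg h0 η
  have a1 := hle ξ hξ
  have b1 := hle η hη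
  generalize (inner ℂ (T ξ) ξ).re = p at *
  generalize (inner ℂ (T η) η).re = q at *
  have k1 := key p q a0 a1 b0 b1
  have k2 := key (1 - p) (1 - q) (by linarith) (by linarith) (by linarith) (by linarith)
  have s1 := Real.sq_sqrt a0
  have s2 := Real.sq_sqrt b0
  have s3 := Real.sq_sqrt (sub_nonneg.2 a1)
  have s4 := Real.sq_sqrt (sub_nonneg.2 b1)
  nlinarith

end

end Affinity

/-! ### Spectral affinity for representations of the semidirect product -/

section SemidirectProduct

variable {Γ₀ Γ A : Type*} [Group Γ₀] [Group Γ] [CommGroup A] {ρ : Γ₀ →* MulAut A} {p : Γ →* Γ₀}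
variable {H : Type*} [NormedAddCommGroup H] [InnerProductSpace ℂ H] [CompleteSpace H]

/-- The bicommutant of the normal abelian subgroup in a representation of a semidirect product. -/
def abelianPart (π : A ⋊[ρ.comp p] Γ →* unitary (H →L[ℂ] H)) : Subalgebra ℂ (H →L[ℂ] H) :=
  Subalgebra.centralizer ℂ (Set.centralizer
    (Set.range fun a : A => (π (SemidirectProduct.inl a) : H →L[ℂ] H)))

variable (π : A ⋊[ρ.comp p] Γ →* unitary (H →L[ℂ] H))

theorem mem_abelianPart_inl (a : A) :
    (π (SemidirectProduct.inl a) : H →L[ℂ] H) ∈ abelianPart π :=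
  Set.subset_centralizer_centralizer ⟨a, rfl⟩

theorem commute_of_mem_abelianPart : ∀ S ∈ abelianPart π, ∀ T ∈ abelianPart π, Commute S T := by
  refine fun S hS T hT => Set.centralizer_centralizer_comm_of_comm ?_ S hS T hT
  rintro _ ⟨a, rfl⟩ _ ⟨b, rfl⟩
  simp only [← Submonoid.coe_mul, ← map_mul, mul_comm]

/-- The kernel of `p` acts trivially on `A`, so its image lies in the commutant of `π(A)`. This is
what lets the affinity descend to `Γ₀`. -/
theorem commute_of_mem_abelianPart_of_ker {k : Γ} (hk : p k = 1) {T : H →L[ℂ] H}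
    (hT : T ∈ abelianPart π) : Commute (π (SemidirectProduct.inr k) : H →L[ℂ] H) T := by
  refine hT _ ?_
  rintro _ ⟨a, rfl⟩
  simp only [← Submonoid.coe_mul, ← map_mul]
  congr 2
  ext <;> simp [hk]

/-- Conjugation by `g` permutes the operators of `A`, hence preserves their commutant and
bicommutant. -/
theorem conj_mem_abelianPart (g : Γ) {T : H →L[ℂ] H} (hT : T ∈ abelianPart π) :
    (π (SemidirectProduct.inr g) : H →L[ℂ] H) * T * star (π (SemidirectProduct.inr g) : H →L[ℂ] H) ∈
      abelianPart π := by
  intro S hS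
  set U : unitary (H →L[ℂ] H) := π (SemidirectProduct.inr g) with hU
  have h1 : star (U : H →L[ℂ] H) * U = 1 := Unitary.coe_star_mul_self U
  have h2 : (U : H →L[ℂ] H) * star (U : H →L[ℂ] H) = 1 := Unitary.coe_mul_star_self U
  have hS' : star (U : H →L[ℂ] H) * S * U ∈ Set.centralizer
      (Set.range fun a : A => (π (SemidirectProduct.inl a) : H →L[ℂ] H)) := by
    rintro _ ⟨a, rfl⟩
    have hconj : (U : H →L[ℂ] H) * (π (SemidirectProduct.inl a) : H →L[ℂ] H) =
        (π (SemidirectProduct.inl (ρ (p g) a)) : H →L[ℂ] H) * U := by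
      simp only [hU, ← Submonoid.coe_mul, ← map_mul]
      congr 2
      ext <;> simp
    have hS2 := hS _ ⟨ρ (p g) a, rfl⟩
    simp only at hS2 ⊢
    generalize (π (SemidirectProduct.inl (ρ (p g) a)) : H →L[ℂ] H) = W at hS2 hconj
    generalize (π (SemidirectProduct.inl a) : H →L[ℂ] H) = V at hconj ⊢
    have hV : V * star (U : H →L[ℂ] H) = star (U : H →L[ℂ] H) * W := by
      calc V * star (U : H →L[ℂ] H)
          = star (U : H →L[ℂ] H) * (U * V) * star (U : H →L[ℂ] H) := by
            rw [← mul_assoc, h1, one_mul]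
        _ = _ := by rw [hconj, mul_assoc, mul_assoc, h2, mul_one]
    calc V * (star (U : H →L[ℂ] H) * S * U) = star (U : H →L[ℂ] H) * (W * S) * U := by
          rw [← mul_assoc, ← mul_assoc, hV, mul_assoc _ W S]
      _ = star (U : H →L[ℂ] H) * S * (W * U) := by rw [hS2]; simp only [mul_assoc]
      _ = _ := by rw [← hconj]; simp only [mul_assoc]
  have := hT _ hS'
  calc S * (U * T * star (U : H →L[ℂ] H))
      = U * ((star (U : H →L[ℂ] H) * S * U) * T) * star (U : H →L[ℂ] H) := by
        simp only [← mul_assoc, h2, one_mul]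
    _ = _ := by
        rw [this]
        simp only [mul_assoc, h2, mul_one]

theorem star_conj_mem_abelianPart (g : Γ) {T : H →L[ℂ] H} (hT : T ∈ abelianPart π) :
    star (π (SemidirectProduct.inr g) : H →L[ℂ] H) * T * (π (SemidirectProduct.inr g) : H →L[ℂ] H) ∈
      abelianPart π := by
  have h := conj_mem_abelianPart π g⁻¹ hT
  simpa [← Unitary.star_eq_inv] using h

/-- The function of positive type on the quotient measuring how much the spectral measure on the
dual of `A` of a vector is moved. -/
noncomputable def spectralAffinity (hp : Function.Surjective p) (ξ : H) (γ : Γ₀) : ℝ :=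
  affinity (abelianPart π) ξ ((π (SemidirectProduct.inr (Function.surjInv hp γ)) : H →L[ℂ] H) ξ)

variable (hp : Function.Surjective p)

theorem affinity_eq_of_map_eq {g h : Γ} (hgh : p g = p h) (ξ η : H) :
    affinity (abelianPart π) ξ ((π (SemidirectProduct.inr g) : H →L[ℂ] H) η) =
      affinity (abelianPart π) ξ ((π (SemidirectProduct.inr h) : H →L[ℂ] H) η) := by
  have hk : p (g * h⁻¹) = 1 := by simp [hgh]
  rw [← affinity_unitary_right (π (SemidirectProduct.inr (g * h⁻¹)))
    (fun T hT => commute_of_mem_abelianPart_of_ker π hk hT) ξ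
    ((π (SemidirectProduct.inr h) : H →L[ℂ] H) η), ← mul_apply_eq_comp, ← Submonoid.coe_mul, ← map_mul, ← map_mul, inv_mul_cancel_right]

theorem spectralAffinity_map (ξ : H) (g : Γ) : spectralAffinity π hp ξ (p g) =
    affinity (abelianPart π) ξ ((π (SemidirectProduct.inr g) : H →L[ℂ] H) ξ) :=
  affinity_eq_of_map_eq π (Function.surjInv_eq hp _) ξ ξ

theorem isPositiveType_spectralAffinity (ξ : H) : IsPositiveType (spectralAffinity π hp ξ) := by
  have h := posSemidef_affinity (commute_of_mem_abelianPart π) fun γ : Γ₀ =>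
    (π (SemidirectProduct.inr (Function.surjInv hp γ)) : H →L[ℂ] H) ξ
  refine (congrArg Matrix.PosSemidef ?_).mpr h
  ext γ γ'
  rw [Matrix.of_apply, Matrix.of_apply]
  congr 1
  have h2 := spectralAffinity_map π hp ξ ((Function.surjInv hp γ)⁻¹ * Function.surjInv hp γ')
  rw [map_mul, map_inv, Function.surjInv_eq hp, Function.surjInv_eq hp] at h2
  rw [h2, ← affinity_unitary (π (SemidirectProduct.inr (Function.surjInv hp γ)))
    (fun T => star_conj_mem_abelianPart π _) (fun T => conj_mem_abelianPart π _),
    ← mul_apply_eq_comp, ← Submonoid.coe_mul, ← map_mul, ← map_mul, mul_inv_cancel_left]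

theorem spectralAffinity_nonneg (ξ : H) (γ : Γ₀) : 0 ≤ spectralAffinity π hp ξ γ :=
  affinity_nonneg _ _

theorem spectralAffinity_le_one {ξ : H} (hξ : ‖ξ‖ = 1) (γ : Γ₀) : spectralAffinity π hp ξ γ ≤ 1 :=
  (affinity_le _ _).trans_eq (by rw [Unitary.norm_map, hξ, one_mul])

theorem spectralAffinity_one {ξ : H} (hξ : ‖ξ‖ = 1) : spectralAffinity π hp ξ 1 = 1 := by
  have h := spectralAffinity_map π hp ξ 1
  rw [map_one] at h
  rw [h]
  simp [affinity_self, hξ]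

theorem re_inner_le_spectralAffinity (ξ : H) (γ : Γ₀) :
    (inner ℂ ξ ((π (SemidirectProduct.inr (Function.surjInv hp γ)) : H →L[ℂ] H) ξ)).re ≤
      spectralAffinity π hp ξ γ :=
  re_inner_le_affinity _ _

/-- Conjugation turns the coefficient of `ρ γ a` at the moved vector into that of `a` at `ξ`. The
test operator halves real parts of coefficients, which turns the constant `4` into `16`. -/
theorem sq_sub_le_one_sub_spectralAffinity {ξ : H} (hξ : ‖ξ‖ = 1) (γ : Γ₀) (a : A) :
    ((inner ℂ ((π (SemidirectProduct.inl (ρ γ a)) : H →L[ℂ] H) ξ) ξ).re -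
      (inner ℂ ((π (SemidirectProduct.inl a) : H →L[ℂ] H) ξ) ξ).re) ^ 2 / 16 ≤
      1 - spectralAffinity π hp ξ γ := by
  obtain ⟨g, rfl⟩ := hp γ
  rw [spectralAffinity_map]
  set b := ρ (p g) a
  set V : unitary (H →L[ℂ] H) := π (SemidirectProduct.inl b) with hV
  set U : unitary (H →L[ℂ] H) := π (SemidirectProduct.inr g) with hU
  -- the positive contraction `(2 + V + V⋆) / 4`, a multiple of `(1 + V)⋆ (1 + V)`
  have hVD : (V : H →L[ℂ] H) ∈ abelianPart π := mem_abelianPart_inl π b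
  have hVD' : star (V : H →L[ℂ] H) ∈ abelianPart π := by
    have := mem_abelianPart_inl π b⁻¹
    rwa [map_inv, map_inv, ← hV, ← Unitary.star_eq_inv, Unitary.coe_star] at this
  have h1 : star (V : H →L[ℂ] H) * V = 1 := Unitary.coe_star_mul_self V
  let T : H →L[ℂ] H := (1 / 4 : ℝ) • (star (1 + (V : H →L[ℂ] H)) * (1 + V))
  have hTD : T ∈ abelianPart π := by
    simp only [T]
    rw [star_add, star_one]
    exact Subalgebra.smul_mem _ (mul_mem (add_mem (one_mem _) hVD') (add_mem (one_mem _) hVD))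
      ((1 / 4 : ℝ) : ℂ)
  have hT0 : 0 ≤ T := smul_nonneg (by norm_num) (star_mul_self_nonneg _)
  have hT1 : T ≤ 1 := by
    have h2 : 1 - T = (1 / 4 : ℝ) • (star (1 - (V : H →L[ℂ] H)) * (1 - V)) := by
      simp only [T, star_add, star_sub, star_one, add_mul, mul_add, sub_mul, mul_sub, one_mul,
        mul_one, h1]
      module
    rw [← sub_nonneg, h2]
    exact smul_nonneg (by norm_num) (star_mul_self_nonneg _)
  have hval : ∀ η : H, ‖η‖ = 1 →
      (inner ℂ (T η) η).re = (1 + (inner ℂ ((V : H →L[ℂ] H) η) η).re) / 2 := by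
    intro η hη
    have h3 : ‖η + (V : H →L[ℂ] H) η‖ ^ 2 = 2 + 2 * (inner ℂ ((V : H →L[ℂ] H) η) η).re := by
      rw [norm_add_sq (𝕜 := ℂ), Unitary.norm_map, hη, inner_re_symm, RCLike.re_eq_complex_re]
      ring
    have h4 : inner ℂ (T η) η = ((1 / 4 : ℝ) : ℂ) * ((‖η + (V : H →L[ℂ] H) η‖ ^ 2 : ℝ) : ℂ) := by
      simp only [T]
      rw [smul_apply, RCLike.real_smul_eq_coe_smul (K := ℂ), inner_smul_left, mul_apply_eq_comp,
        ContinuousLinearMap.star_eq_adjoint, ContinuousLinearMap.adjoint_inner_left,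
        inner_self_eq_norm_sq_to_K, RCLike.conj_ofReal]
      simp
    rw [h4, ← Complex.ofReal_mul, Complex.ofReal_re, h3]
    ring
  have hη : ‖(U : H →L[ℂ] H) ξ‖ = 1 := by rw [Unitary.norm_map, hξ]
  have hmain := sq_sub_le_one_sub_affinity hTD hT0 hT1 hξ hη
  have hconj : inner ℂ ((V : H →L[ℂ] H) ((U : H →L[ℂ] H) ξ)) ((U : H →L[ℂ] H) ξ) =
      inner ℂ ((π (SemidirectProduct.inl a) : H →L[ℂ] H) ξ) ξ := by
    have h3 : V * U = U * π (SemidirectProduct.inl a) := by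
      rw [hV, hU, ← map_mul, ← map_mul]
      congr 1
      ext <;> simp [b]
    rw [← mul_apply_eq_comp, ← Submonoid.coe_mul, h3, Submonoid.coe_mul, mul_apply_eq_comp,
      Unitary.inner_map_map]
  rw [hval _ hξ, hval _ hη, hconj] at hmain
  refine le_trans (le_of_eq ?_) hmain
  ring

theorem tendsto_spectralAffinity {ξ : ℕ → H} (hξ : ∀ n, ‖ξ n‖ = 1)
    (hinv : ∀ g, Tendsto (fun n => (inner ℂ ((π g : H →L[ℂ] H) (ξ n)) (ξ n)).re) atTop (𝓝 1))
    (γ : Γ₀) : Tendsto (fun n => spectralAffinity π hp (ξ n) γ) atTop (𝓝 1) := by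
  refine tendsto_of_tendsto_of_tendsto_of_le_of_le
    (hinv (SemidirectProduct.inr (Function.surjInv hp γ))) tendsto_const_nhds (fun n => ?_)
    fun n => spectralAffinity_le_one π hp (hξ n) γ
  refine le_trans (le_of_eq ?_) (re_inner_le_spectralAffinity π hp (ξ n) γ)
  exact inner_re_symm (𝕜 := ℂ) _ _

end SemidirectProduct

/-! ### Transfer between `Γ₀` and the semidirect product -/

namespace CountableGroup

/-- In a countable group, almost invariant vectors can be chosen in a sequence. -/
theorem HasAlmostInvariantVectors.exists_seq {G H : Type*} [Group G] [Countable G]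
    [NormedAddCommGroup H] [InnerProductSpace ℂ H] [CompleteSpace H]
    {π : G →* unitary (H →L[ℂ] H)} (h : HasAlmostInvariantVectors π) :
    ∃ ξ : ℕ → H, (∀ n, ‖ξ n‖ = 1) ∧
      ∀ g, Tendsto (fun n => (inner ℂ ((π g : H →L[ℂ] H) (ξ n)) (ξ n)).re) atTop (𝓝 1) := by
  classical
  obtain ⟨f, hf⟩ := exists_surjective_nat G
  choose ξ hξ hinv using fun n : ℕ =>
    h (1 / (n + 1)) Nat.one_div_pos_of_nat ((Finset.range (n + 1)).image f)
  refine ⟨ξ, hξ, fun g => ?_⟩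
  obtain ⟨i, rfl⟩ := hf g
  have hlim : Tendsto (fun n => ‖(π (f i) : H →L[ℂ] H) (ξ n) - ξ n‖) atTop (𝓝 0) := by
    refine squeeze_zero' (.of_forall fun _ => norm_nonneg _) ?_ tendsto_one_div_add_atTop_nhds_zero_nat
    filter_upwards [eventually_ge_atTop i] with n hn
    exact hinv n _ (Finset.mem_image_of_mem f (Finset.mem_range.2 (by lia)))
  have h2 := ((hlim.pow 2).div_const 2).const_sub 1
  norm_num at h2
  refine h2.congr fun n => ?_
  rw [norm_sub_sq (𝕜 := ℂ), Unitary.norm_map, hξ, RCLike.re_eq_complex_re]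
  ring

/-- Relative property (T) passes from `X` to the translates by `X` of an element of `A`. -/
theorem hasRelativePropertyT_image_inl {Γ₀ Γ A : Type*} [Group Γ₀] [Countable Γ₀]
    [Group Γ] [Countable Γ] [CommGroup A] [Countable A] {ρ : Γ₀ →* MulAut A} {p : Γ →* Γ₀}
    (hp : Function.Surjective p) {X : Set Γ₀}
    (hX : HasRelativePropertyT.{v} X) (a : A) :
    HasRelativePropertyT.{v}
      ((SemidirectProduct.inl : A →* A ⋊[ρ.comp p] Γ) '' ((fun γ : Γ₀ => ρ γ a) '' X)) := by
  have : Countable (A ⋊[ρ.comp p] Γ) := SemidirectProduct.equivProd.countable_iff.2 inferInstance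
  intro H _ _ _ π hπ ε hε
  obtain ⟨ξ, hξ, hinv⟩ := hπ.exists_seq
  -- The (T) criterion yields only some index `n`, so the sequence is shifted beforehand to make
  -- every term good at `a`.
  obtain ⟨N, hN⟩ := eventually_atTop.1
    ((hinv (SemidirectProduct.inl a)).eventually_const_lt
      (show 1 - ε ^ 2 / 4 < 1 by linarith [sq_pos_of_pos hε]))
  obtain ⟨n, hn⟩ := hX.exists_forall_lt (φ := fun n => spectralAffinity π hp (ξ (n + N)))
    (fun n => isPositiveType_spectralAffinity π hp _) (fun n => spectralAffinity_nonneg π hp _)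
    (fun n => spectralAffinity_le_one π hp (hξ _)) (fun n => spectralAffinity_one π hp (hξ _))
    (fun γ => (tendsto_spectralAffinity π hp hξ hinv γ).comp (tendsto_add_atTop_nat N))
    -- Real parts at `a` and `ρ γ a` then differ by less than `ε ^ 2 / 4`, so the latter exceeds `1
    -- - ε ^ 2 / 2`: displacement below `ε`.
    (c := 1 - (ε ^ 2 / 4) ^ 2 / 16) (by
      have : 0 < (ε ^ 2 / 4) ^ 2 := by positivity
      linarith)
  refine ⟨ξ (n + N), hξ _, ?_⟩
  rintro _ ⟨_, ⟨γ, hγ, rfl⟩, rfl⟩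
  have h1 := sq_sub_le_one_sub_spectralAffinity π hp (hξ (n + N)) γ a
  have h2 := hn γ hγ
  have h3 := hN (n + N) (Nat.le_add_left _ _)
  have h4 := abs_lt_of_sq_lt_sq' ((div_lt_div_iff_of_pos_right (by norm_num : (0 : ℝ) < 16)).1
    (h1.trans_lt (show _ < (ε ^ 2 / 4) ^ 2 / 16 by linarith))) (by positivity)
  refine (sq_le_sq₀ (norm_nonneg _) hε.le).1 ?_
  rw [norm_sub_sq (𝕜 := ℂ), Unitary.norm_map, hξ, RCLike.re_eq_complex_re]
  linarith [h4.1]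

theorem IsHaagerup.of_semidirectProduct {Γ₀ Γ A : Type*} [Group Γ₀] [Countable Γ₀]
    [Group Γ] [Countable Γ] [CommGroup A] [Countable A] {ρ : Γ₀ →* MulAut A} {p : Γ →* Γ₀}
    (hp : Function.Surjective p) {a : A}
    (ha : {γ : Γ₀ | ρ γ a = a}.Finite) (h : IsHaagerup.{v} (A ⋊[ρ.comp p] Γ)) :
    IsHaagerup.{v} Γ₀ := by
  have : Countable (A ⋊[ρ.comp p] Γ) := SemidirectProduct.equivProd.countable_iff.2 inferInstance
  obtain ⟨H, _, _, _, π, hc0, hai⟩ := h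
  obtain ⟨ξ, hξ, hinv⟩ := hai.exists_seq
  obtain ⟨N, hN⟩ := eventually_atTop.1
    ((hinv (SemidirectProduct.inl a)).eventually_const_lt (show (1 / 2 : ℝ) < 1 by norm_num))
  have hfin : Tendsto (fun γ : Γ₀ => (SemidirectProduct.inl (ρ γ a) : A ⋊[ρ.comp p] Γ))
      cofinite cofinite := by
    refine SemidirectProduct.inl_injective.tendsto_cofinite.comp ?_
    refine Tendsto.cofinite_of_finite_preimage_singleton fun b => ?_
    rcases Set.eq_empty_or_nonempty ((fun γ : Γ₀ => ρ γ a) ⁻¹' {b}) with hb | ⟨γ₁, hγ₁⟩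
    · rw [hb]
      exact Set.finite_empty
    -- A nonempty fibre of the orbit map is a left coset of the finite stabilizer.
    · refine (ha.image fun γ => γ₁ * γ).subset fun γ hγ => ⟨γ₁⁻¹ * γ, ?_, by simp⟩
      have h1 : ρ γ a = ρ γ₁ a := Eq.trans hγ (Eq.symm hγ₁)
      simp [h1]
  refine isHaagerup_of_isPositiveType (φ := fun n => spectralAffinity π hp (ξ (n + N)))
    (fun n => isPositiveType_spectralAffinity π hp _) (fun n => spectralAffinity_nonneg π hp _)
    (fun n => spectralAffinity_le_one π hp (hξ _)) (fun n => spectralAffinity_one π hp (hξ _))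
    (fun γ => (tendsto_spectralAffinity π hp hξ hinv γ).comp (tendsto_add_atTop_nat N))
    -- The gap `1 / 4` separates the real part at `a`, above `1 / 2`, from that at `ρ γ a`, below `1
    -- / 4` for all but finitely many `γ`.
    (c := 1 - (1 / 4) ^ 2 / 16) (by norm_num) fun n => ?_
  have hz := ((Complex.continuous_re.tendsto' 0 0 Complex.zero_re).comp
    (hc0 (ξ (n + N)) (ξ (n + N)))).comp hfin
  filter_upwards [hz.eventually_lt_const (show (0 : ℝ) < 1 / 4 by norm_num)] with γ hγ
  have h1 := sq_sub_le_one_sub_spectralAffinity π hp (hξ (n + N)) γ a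
  have h3 := hN (n + N) (Nat.le_add_left _ _)
  simp only [Function.comp_apply] at hγ
  nlinarith

end CountableGroup

end

theorem theorem3p1 {Γ₀ Γ A : Type*} [Group Γ₀] [Countable Γ₀] [Group Γ] [Countable Γ]
    [CommGroup A] [Countable A] (ρ : Γ₀ →* MulAut A) (p : Γ →* Γ₀)
    (hp : Function.Surjective p) :
    (∀ X : Set Γ₀, CountableGroup.HasRelativePropertyT.{v} X → ∀ a : A,
      CountableGroup.HasRelativePropertyT.{v}
        ((SemidirectProduct.inl : A →* A ⋊[ρ.comp p] Γ) '' ((fun γ : Γ₀ => ρ γ a) '' X))) ∧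
    ((∃ a : A, {γ : Γ₀ | ρ γ a = a}.Finite) → ¬ CountableGroup.IsHaagerup.{v} Γ₀ →
      ¬ CountableGroup.IsHaagerup.{v} (A ⋊[ρ.comp p] Γ)) := by
  exact ⟨fun _ hX a => CountableGroup.hasRelativePropertyT_image_inl hp hX a,
    fun ⟨_, ha⟩ hnot h => hnot (h.of_semidirectProduct hp ha)⟩
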